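/- Let $a=(a_n)_{n\ge 0}$ be a sequence of positive numbers and $b=(b_n)_{n\ge 0}$ a sequence of real numbers. A generalized eigenvector associated with $x\in\mathbb R$ is a non-zero real sequence $(u_n)_{n\ge 0}$ such that $a_{n-1}u_{n-1}+b_nu_n+a_nu_{n+1}=xu_n$ for all $n\ge 1$. For $n\ge 1$ put \[ B_n(x)=\begin{pmatrix}0&1\\ -\frac{a_{n-1}}{a_n}&\frac{x-b_n}{a_n}\end{pmatrix}. \] Let $N$ and $r$ be positive integers, let $i\in\{0,\dots,N-1\}$, and for $n\ge 1$ let $X_n=B_{n+N-1}B_{n+N-2}\cdots B_n$ be the $N$-step transfer matrix. Write $\operatorname{discr}X=(\operatorname{tr}X)^2-4\det X$ for a $2\times 2$ matrix $X$. Let $K$ be a compact subset of \[ \Lambda=\Big\{x\in\mathbb R:\ \lim_{n\to\infty}\operatorname{discr}\big(X_{nN+i}(x)\big)\text{ exists and is negative}\Big\}. \] Assume that \[ \lim_{n\to\infty}\frac{a_{(n+1)N+i-1}}{a_{nN+i-1}}=1 \] and that $(X_{nN+i})_{n\ge 1}$ belongs to $\mathcal D_r(K,\operatorname{GL}(2,\mathbb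 R))$. Here a sequence $(A_n)_{n\ge 1}$ of continuous mappings $K\to\operatorname{GL}(2,\mathbb R)$ belongs to $\mathcal D_r(K,\operatorname{GL}(2,\mathbb R))$ if it is uniformly bounded on $K$ and \[ \sum_{n\ge 1}\sup_{x\in K}\big\|\Delta^jA_n(x)\big\|^{r/j}<\infty\qquad\text{for each } j\in\{1,\dots,r\}, \] where $\Delta^0A_n=A_n$ and $\Delta^jA_n=\Delta^{j-1}A_{n+1}-\Delta^{j-1}A_n$. Then there is a constant $c>1$ such that for every $x\in K$, every generalized eigenvector $(u_n)_{n\ge 0}$ associated with $x$, and every $n\ge 1$, \[ c^{-1}\big(u_0^2+u_1^2\big)\le a_{nN+i-1}\big(u_{nN+i-1}^2+u_{nN+i}^2\big)\le c\big(u_0^2+u_1^2\big). \] -/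

import Mathlib

open scoped Matrix Topology
open scoped Matrix.Norms.L2Operator

namespace JacobiTransfer

/-- The one-step transfer matrix `B_n(x)` of the Jacobi parameters `a`, `b`. It is only meaningful,
and only used, for `n ≥ 1`. -/
noncomputable def oneStep (a b : ℕ → ℝ) (n : ℕ) (x : ℝ) : Matrix (Fin 2) (Fin 2) ℝ :=
  !![0, 1; -(a (n - 1) / a n), (x - b n) / a n]

/-- The ordered product `B_{n+N-1}(x) ⋯ B_{n+1}(x) B_n(x)` of `N` one-step transfer matrices
(the factor with the largest index stands on the left). -/
noncomputable def nStep (a b : ℕ → ℝ) : (N : ℕ) → (n : ℕ) → (x : ℝ) → Matrix (Fin 2) (Fin 2) ℝ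
  | 0, _, _ => 1
  | N + 1, n, x => oneStep a b (n + N) x * nStep a b N n x

/-- `u` is a generalized eigenvector associated with `x`: a non-zero real sequence with
`a_{n-1} u_{n-1} + b_n u_n + a_n u_{n+1} = x u_n` for all `n ≥ 1`. -/
def IsGenEigenvector (a b : ℕ → ℝ) (x : ℝ) (u : ℕ → ℝ) : Prop :=
  u ≠ 0 ∧ ∀ n : ℕ, 1 ≤ n → a (n - 1) * u (n - 1) + b n * u n + a n * u (n + 1) = x * u n

/-- The iterated forward difference `Δ^j A_n`, pointwise in `x`. -/
def iterDiff (A : ℕ → ℝ → Matrix (Fin 2) (Fin 2) ℝ) :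
    (j : ℕ) → (n : ℕ) → (x : ℝ) → Matrix (Fin 2) (Fin 2) ℝ
  | 0, n, x => A n x
  | j + 1, n, x => iterDiff A j (n + 1) x - iterDiff A j n x

/-- The sequence `(A_n : n ≥ 1)`, restricted to `K`, belongs to `D_r(K, GL(2, ℝ))`: it consists of
continuous mappings `K → GL(2, ℝ)`, is uniformly bounded on `K`, and
`∑_{n ≥ 1} (sup_{x ∈ K} ‖Δ^j A_n(x)‖)^{r/j} < ∞` for `j = 1, …, r`. The norm is the operator norm
for the Euclidean norm of `ℝ²`; the suprema are of bounded sets because of uniform boundedness. -/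
structure InStolzClass (r : ℕ) (K : Set ℝ) (A : ℕ → ℝ → Matrix (Fin 2) (Fin 2) ℝ) : Prop where
  continuousOn : ∀ n : ℕ, 1 ≤ n → ContinuousOn (A n) K
  isUnit : ∀ n : ℕ, 1 ≤ n → ∀ x ∈ K, IsUnit (A n x)
  bounded : ∃ C : ℝ, ∀ n : ℕ, 1 ≤ n → ∀ x ∈ K, ‖A n x‖ ≤ C
  summable : ∀ j : ℕ, 1 ≤ j → j ≤ r →
    Summable fun n : ℕ => (⨆ x : K, ‖iterDiff A j (n + 1) x‖) ^ ((r : ℝ) / (j : ℝ))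

/-- The set `Λ` of real `x` at which the discriminants (`discr X = (tr X)² - 4 det X`, see
`Matrix.discr_fin_two`) of the matrices `X_{kN+i}(x)` converge, as `k → ∞`, to a negative number. -/
def ellipticSet (a b : ℕ → ℝ) (N i : ℕ) : Set ℝ :=
  {x | ∃ h : ℝ, h < 0 ∧ Filter.Tendsto
    (fun k : ℕ => (nStep a b N (k * N + i) x).discr)
    Filter.atTop (𝓝 h)}

end JacobiTransfer

/-! Write A_n for the N-step transfer matrices, T_n for their traceless parts and α_n for the
matching off-diagonal weights, so that α_{n+1} det A_n = α_n. On K the discriminants are eventually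
uniformly negative, which says that det T_n is bounded below by a positive constant. A traceless S
with positive determinant gives a definite quadratic form v ↦ det(v, Sv). If S_{n+1} were exactly (1
+ λ_n) A_n S_n A_n⁻¹, then det(v, S_n v)² / det S_n would be multiplied by (det A_n)² along v_{n+1}
= A_n v_n, and α_n² times it would be conserved.

The choice S_n = T_n, λ_n = 0 satisfies this relation up to a first-order difference, since T_n
commutes with A_n. That error is not summable when r > 1, so it is improved one order at a time
(`exists_slow_defect`): conjugation by A_n is inverted on the complement of T_n in the traceless
matrices, and the component along T_n goes into λ_n. Order r makes the error summable. The sequence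
λ_n stays of order one only, but dividing by det S_n cancels it.

Hence α_n |v_n|² is bounded above by its initial value (`exists_normSq_le`). The lower bound comes
from the upper one through the conserved Wronskian with a second solution
(`exists_normSq_le_and_le`). Finitely many steps of the recurrence relate the data at the starting
index to u_0, u_1. -/

namespace JacobiTransfer

/-! ### Calculus of sequences whose successive differences gain powers of an r-summable majorant -/

section SlowSequences

variable {ι : Type*} {r : ℕ} {J k l : ℕ} {f g : ℕ → ι → ℝ}

/-- `f_n = O(s_n^k)` uniformly in the parameter, for some `s` with values in `[0, 1]` and summable `r`-th
powers; exponents beyond `r` are truncated to `r`. -/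
def PowerBounded (r : ℕ) (k : ℕ) (f : ℕ → ι → ℝ) : Prop :=
  ∃ s : ℕ → ℝ, (∀ n, 0 ≤ s n) ∧ (∀ n, s n ≤ 1) ∧ Summable (fun n => s n ^ r) ∧
    ∃ C : ℝ, 0 ≤ C ∧ ∀ n x, |f n x| ≤ C * s n ^ min k r

/-- The forward difference in the index. -/
def fdiff (f : ℕ → ι → ℝ) : ℕ → ι → ℝ := fun n x => f (n + 1) x - f n x

/-- The shift of the index. -/
def shift (f : ℕ → ι → ℝ) : ℕ → ι → ℝ := fun n x => f (n + 1) x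

/-- The first `J` differences of `f` are power bounded, with exponents increasing from `k`. -/
def SlowUpTo (r : ℕ) : (J : ℕ) → (k : ℕ) → (ℕ → ι → ℝ) → Prop
  | 0, k, f => PowerBounded r k f
  | J + 1, k, f => PowerBounded r k f ∧ SlowUpTo r J (k + 1) (fdiff f)

/-- All differences of `f` are power bounded, with exponents increasing from `k`. -/
def Slow (r : ℕ) (k : ℕ) (f : ℕ → ι → ℝ) : Prop := ∀ J, SlowUpTo r J k f

/-- The pointwise maximum of the two majorants serves both families; its r-th power is at most the
sum of theirs. -/
theorem PowerBounded.common (hf : PowerBounded r k f) (hg : PowerBounded r l g) :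
    ∃ s : ℕ → ℝ, (∀ n, 0 ≤ s n) ∧ (∀ n, s n ≤ 1) ∧ Summable (fun n => s n ^ r) ∧
      ∃ C : ℝ, 0 ≤ C ∧ ∀ n x,
        |f n x| ≤ C * s n ^ min k r ∧ |g n x| ≤ C * s n ^ min l r := by
  obtain ⟨s, s0, s1, ss, C, hC, h⟩ := hf
  obtain ⟨t, t0, t1, ts, D, hD, h'⟩ := hg
  refine ⟨fun n => max (s n) (t n), fun n => (s0 n).trans (le_max_left _ _),
    fun n => max_le (s1 n) (t1 n), ?_, max C D, hC.trans (le_max_left _ _), fun n x => ⟨?_, ?_⟩⟩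
  · refine Summable.of_nonneg_of_le (fun n => pow_nonneg ((s0 n).trans (le_max_left _ _)) _)
      (fun n => ?_) (ss.add ts)
    rcases max_choice (s n) (t n) with h | h <;> simp only [h]
    · linarith [pow_nonneg (t0 n) r]
    · linarith [pow_nonneg (s0 n) r]
  · exact (h n x).trans (mul_le_mul (le_max_left _ _)
      (pow_le_pow_left₀ (s0 n) (le_max_left _ _) _) (pow_nonneg (s0 n) _)
      (hC.trans (le_max_left _ _)))
  · exact (h' n x).trans (mul_le_mul (le_max_right _ _)
      (pow_le_pow_left₀ (t0 n) (le_max_right _ _) _) (pow_nonneg (t0 n) _)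
      (hC.trans (le_max_left _ _)))

theorem PowerBounded.add (hf : PowerBounded r k f) (hg : PowerBounded r k g) :
    PowerBounded r k (f + g) := by
  obtain ⟨s, s0, s1, ss, C, hC, h⟩ := hf.common hg
  refine ⟨s, s0, s1, ss, C + C, by positivity, fun n x => ?_⟩
  have := h n x
  simp only [Pi.add_apply]
  rw [add_mul]
  exact (abs_add_le _ _).trans (add_le_add this.1 this.2)

theorem PowerBounded.mul (hf : PowerBounded r k f) (hg : PowerBounded r l g) :
    PowerBounded r (k + l) (f * g) := by
  obtain ⟨s, s0, s1, ss, C, hC, h⟩ := hf.common hg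
  refine ⟨s, s0, s1, ss, C * C, by positivity, fun n x => ?_⟩
  have := h n x
  simp only [Pi.mul_apply]
  rw [abs_mul]
  refine (mul_le_mul this.1 this.2 (abs_nonneg _) (mul_nonneg hC (pow_nonneg (s0 n) _))).trans ?_
  rw [mul_mul_mul_comm, ← pow_add]
  refine mul_le_mul_of_nonneg_left (pow_le_pow_of_le_one (s0 n) (s1 n) ?_) (by positivity)
  omega

theorem PowerBounded.shift (hf : PowerBounded r k f) : PowerBounded r k (shift f) := by
  obtain ⟨s, s0, s1, ss, C, hC, h⟩ := hf
  exact ⟨fun n => s (n + 1), fun n => s0 _, fun n => s1 _, (summable_nat_add_iff 1).2 ss, C, hC,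
    fun n x => h _ x⟩

theorem PowerBounded.mono (hf : PowerBounded r k f) (hl : l ≤ k) : PowerBounded r l f := by
  obtain ⟨s, s0, s1, ss, C, hC, h⟩ := hf
  refine ⟨s, s0, s1, ss, C, hC, fun n x => (h n x).trans ?_⟩
  exact mul_le_mul_of_nonneg_left (pow_le_pow_of_le_one (s0 n) (s1 n) (by omega)) hC

/-- Truncation at r makes all exponents from r on equivalent, so differences of order beyond r need
no hypothesis of their own. -/
theorem PowerBounded.of_le (hk : r ≤ k) (hf : PowerBounded r k f) : PowerBounded r l f := by
  obtain ⟨s, s0, s1, ss, C, hC, h⟩ := hf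
  refine ⟨s, s0, s1, ss, C, hC, fun n x => (h n x).trans ?_⟩
  exact mul_le_mul_of_nonneg_left (pow_le_pow_of_le_one (s0 n) (s1 n) (by omega)) hC

theorem PowerBounded.const_mul (c : ℝ) (hf : PowerBounded r k f) :
    PowerBounded r k (fun n x => c * f n x) := by
  obtain ⟨s, s0, s1, ss, C, hC, h⟩ := hf
  refine ⟨s, s0, s1, ss, |c| * C, by positivity, fun n x => ?_⟩
  rw [abs_mul, mul_assoc]
  exact mul_le_mul_of_nonneg_left (h n x) (abs_nonneg c)

theorem PowerBounded.of_bounded (hr : r ≠ 0) (C : ℝ) (h : ∀ n x, |f n x| ≤ C) :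
    PowerBounded r 0 f := by
  -- The zero majorant suffices because `0 ^ 0 = 1`; its r-th powers are summable because r is
  -- non-zero.
  refine ⟨fun _ => 0, fun _ => le_rfl, fun _ => zero_le_one, ?_, |C|, abs_nonneg C, fun n x => ?_⟩
  · simp [hr, summable_zero]
  · simpa using (h n x).trans (le_abs_self C)

theorem PowerBounded.zero (hr : r ≠ 0) : PowerBounded r k (0 : ℕ → ι → ℝ) := by
  refine ⟨fun _ => 0, fun _ => le_rfl, fun _ => zero_le_one, ?_, 0, le_rfl, fun n x => ?_⟩
  · simp [hr, summable_zero]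
  · simp

theorem PowerBounded.exists_bound (h : PowerBounded r k f) : ∃ C, 0 ≤ C ∧ ∀ n x, |f n x| ≤ C := by
  obtain ⟨s, s0, s1, ss, C, hC, h⟩ := h
  exact ⟨C, hC, fun n x => (h n x).trans (mul_le_of_le_one_right hC (pow_le_one₀ (s0 n) (s1 n)))⟩

theorem PowerBounded.exists_summable (h : PowerBounded r r f) :
    ∃ s : ℕ → ℝ, (∀ n, 0 ≤ s n) ∧ Summable s ∧ ∀ n x, |f n x| ≤ s n := by
  obtain ⟨s, s0, s1, ss, C, hC, h⟩ := h
  refine ⟨fun n => C * s n ^ r, fun n => mul_nonneg hC (pow_nonneg (s0 n) r), ss.mul_left C,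
    fun n x => ?_⟩
  simpa using h n x

/-- A power bounded family of positive exponent tends to zero uniformly. -/
theorem PowerBounded.eventually_le (hr : r ≠ 0) (hk : k ≠ 0) (h : PowerBounded r k f) {ε : ℝ}
    (hε : 0 < ε) : ∀ᶠ n in Filter.atTop, ∀ x, |f n x| ≤ ε := by
  obtain ⟨s, s0, s1, ss, C, hC, h⟩ := h.mono (l := 1) (Nat.one_le_iff_ne_zero.2 hk)
  have h0 := ss.tendsto_atTop_zero
  have hpos : 0 < (ε / (C + 1)) ^ r := by positivity
  filter_upwards [h0.eventually (gt_mem_nhds hpos)] with n hn x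
  have h1 : s n < ε / (C + 1) := lt_of_pow_lt_pow_left₀ r (by positivity) hn
  have h2 := h n x
  rw [min_eq_left (Nat.one_le_iff_ne_zero.2 hr), pow_one] at h2
  rw [lt_div_iff₀ (by positivity)] at h1
  nlinarith [s0 n]

theorem fdiff_add : fdiff (f + g) = fdiff f + fdiff g := by
  ext n x; simp [fdiff]; ring

theorem fdiff_mul : fdiff (f * g) = fdiff f * shift g + f * fdiff g := by
  ext n x; simp [fdiff, shift]; ring

theorem SlowUpTo.powerBounded (h : SlowUpTo r J k f) : PowerBounded r k f := by
  cases J with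
  | zero => exact h
  | succ J => exact h.1

theorem SlowUpTo.pred : ∀ {J k : ℕ} {f : ℕ → ι → ℝ}, SlowUpTo r (J + 1) k f → SlowUpTo r J k f
  | 0, _, _, h => h.1
  | _ + 1, _, _, h => ⟨h.1, h.2.pred⟩

theorem SlowUpTo.mono : ∀ {J k l : ℕ} {f : ℕ → ι → ℝ}, SlowUpTo r J k f → l ≤ k →
    SlowUpTo r J l f
  | 0, _, _, _, h, hl => PowerBounded.mono h hl
  | _ + 1, _, _, _, h, hl => ⟨h.1.mono hl, h.2.mono (by omega)⟩

theorem SlowUpTo.shift : ∀ {J k : ℕ} {f : ℕ → ι → ℝ}, SlowUpTo r J k f →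
    SlowUpTo r J k (shift f)
  | 0, _, _, h => PowerBounded.shift h
  | _ + 1, _, _, h => ⟨h.1.shift, h.2.shift⟩

theorem SlowUpTo.add : ∀ {J k : ℕ} {f g : ℕ → ι → ℝ}, SlowUpTo r J k f → SlowUpTo r J k g →
    SlowUpTo r J k (f + g)
  | 0, _, _, _, h, h' => PowerBounded.add h h'
  | _ + 1, _, _, _, h, h' => ⟨h.1.add h'.1, by rw [fdiff_add]; exact h.2.add h'.2⟩

/-- Discrete Leibniz rule: each term of Δ(fg) differences exactly one factor and so gains one
exponent. -/
theorem SlowUpTo.mul : ∀ {J k l : ℕ} {f g : ℕ → ι → ℝ}, SlowUpTo r J k f → SlowUpTo r J l g →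
    SlowUpTo r J (k + l) (f * g)
  | 0, _, _, _, _, h, h' => PowerBounded.mul h h'
  | J + 1, k, l, f, g, h, h' => ⟨h.1.mul h'.1, by
      rw [fdiff_mul]
      refine SlowUpTo.add ?_ ?_
      · have := h.2.mul h'.pred.shift
        rwa [show k + 1 + l = k + l + 1 by omega] at this
      · have := h.pred.mul h'.2
        rwa [show k + (l + 1) = k + l + 1 by omega] at this⟩

theorem SlowUpTo.zero (hr : r ≠ 0) : ∀ {J k : ℕ}, SlowUpTo r J k (0 : ℕ → ι → ℝ)
  | 0, _ => PowerBounded.zero hr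
  | J + 1, k => ⟨PowerBounded.zero hr, by
      have : fdiff (0 : ℕ → ι → ℝ) = 0 := by ext; simp [fdiff]
      rw [this]; exact SlowUpTo.zero hr⟩

theorem SlowUpTo.const (hr : r ≠ 0) (c : ℝ) :
    ∀ {J : ℕ}, SlowUpTo r J 0 (fun (_ : ℕ) (_ : ι) => c)
  | 0 => PowerBounded.of_bounded hr |c| fun _ _ => le_rfl
  | J + 1 => ⟨PowerBounded.of_bounded hr |c| fun _ _ => le_rfl, by
      have : fdiff (fun (_ : ℕ) (_ : ι) => c) = 0 := by ext; simp [fdiff]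
      rw [this]; exact SlowUpTo.zero hr⟩

theorem Slow.add (h : Slow r k f) (h' : Slow r k g) : Slow r k (f + g) :=
  fun J => (h J).add (h' J)

theorem Slow.mul (h : Slow r k f) (h' : Slow r l g) : Slow r (k + l) (f * g) :=
  fun J => (h J).mul (h' J)

theorem Slow.mono (h : Slow r k f) (hl : l ≤ k) : Slow r l f := fun J => (h J).mono hl

theorem Slow.shift (h : Slow r k f) : Slow r k (shift f) := fun J => (h J).shift

theorem Slow.fdiff (h : Slow r k f) : Slow r (k + 1) (fdiff f) := fun J => (h (J + 1)).2

theorem Slow.powerBounded (h : Slow r k f) : PowerBounded r k f := h 0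

theorem Slow.zero (hr : r ≠ 0) : Slow r k (0 : ℕ → ι → ℝ) := fun _ => SlowUpTo.zero hr

theorem Slow.const (hr : r ≠ 0) (c : ℝ) : Slow r 0 (fun (_ : ℕ) (_ : ι) => c) :=
  fun _ => SlowUpTo.const hr c

theorem Slow.const_mul (hr : r ≠ 0) (c : ℝ) (h : Slow r k f) :
    Slow r k (fun n x => c * f n x) := by
  have := (Slow.const (ι := ι) hr c).mul h
  rwa [zero_add] at this

theorem Slow.sub (hr : r ≠ 0) (h : Slow r k f) (h' : Slow r k g) : Slow r k (f - g) := by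
  have : f - g = f + fun n x => -1 * g n x := by ext; simp; ring
  rw [this]; exact h.add (h'.const_mul hr _)

/-- The difference of 1/f is -Δf times two undifferenced reciprocals, which permits induction on the
number of differences. -/
theorem Slow.inv (hr : r ≠ 0) (h : Slow r 0 f) {δ : ℝ} (hδ : 0 < δ) (hf : ∀ n x, δ ≤ |f n x|) :
    Slow r 0 f⁻¹ := by
  have h0 : ∀ n x, f n x ≠ 0 := fun n x => abs_pos.1 (hδ.trans_le (hf n x))
  have hb : PowerBounded r 0 f⁻¹ := PowerBounded.of_bounded hr δ⁻¹ fun n x => by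
    simp only [Pi.inv_apply, abs_inv]
    exact inv_anti₀ hδ (hf n x)
  intro J
  induction J with
  | zero => exact hb
  | succ J ih =>
    refine ⟨hb, ?_⟩
    have hd : JacobiTransfer.fdiff f⁻¹ =
        (fun n x => -1 * JacobiTransfer.fdiff f n x) * (f⁻¹ * JacobiTransfer.shift f⁻¹) := by
      ext n x
      simp only [JacobiTransfer.fdiff, JacobiTransfer.shift, Pi.mul_apply, Pi.inv_apply]
      field_simp [h0 n x, h0 (n + 1) x]
      ring
    rw [hd]
    exact ((h.fdiff.const_mul hr _) J).mul (ih.mul ih.shift)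

end SlowSequences

/-! ### The same calculus for 2 × 2 matrices, entry by entry -/

section SlowMatrices

variable {ι : Type*} {r k l : ℕ} {M P : ℕ → ι → Matrix (Fin 2) (Fin 2) ℝ} {f : ℕ → ι → ℝ}

/-- All entries of the matrices are slow. -/
def MSlow (r k : ℕ) (M : ℕ → ι → Matrix (Fin 2) (Fin 2) ℝ) : Prop :=
  ∀ i j, Slow r k fun n x => M n x i j

theorem MSlow.add (h : MSlow r k M) (h' : MSlow r k P) : MSlow r k (M + P) :=
  fun i j => (h i j).add (h' i j)

theorem MSlow.sub (hr : r ≠ 0) (h : MSlow r k M) (h' : MSlow r k P) : MSlow r k (M - P) :=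
  fun i j => (h i j).sub hr (h' i j)

theorem MSlow.mul (h : MSlow r k M) (h' : MSlow r l P) : MSlow r (k + l) (M * P) := fun i j => by
  have := ((h i 0).mul (h' 0 j)).add ((h i 1).mul (h' 1 j))
  convert this using 1
  ext n x
  simp [Matrix.mul_apply, Fin.sum_univ_two]

theorem MSlow.smul (h : Slow r k f) (h' : MSlow r l P) :
    MSlow r (k + l) (fun n x => f n x • P n x) := fun i j => by
  exact h.mul (h' i j)

theorem MSlow.mono (h : MSlow r k M) (hl : l ≤ k) : MSlow r l M := fun i j => (h i j).mono hl

theorem MSlow.fdiff (h : MSlow r k M) : MSlow r (k + 1) (fun n x => M (n + 1) x - M n x) :=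
  fun i j => (h i j).fdiff

theorem MSlow.trace (h : MSlow r k M) : Slow r k (fun n x => (M n x).trace) := by
  convert (h 0 0).add (h 1 1) using 1
  ext n x
  simp [Matrix.trace_fin_two]

theorem MSlow.det (hr : r ≠ 0) (h : MSlow r 0 M) : Slow r 0 (fun n x => (M n x).det) := by
  convert ((h 0 0).mul (h 1 1)).sub hr ((h 0 1).mul (h 1 0)) using 1
  ext n x
  simp [Matrix.det_fin_two]

theorem MSlow.adjugate (hr : r ≠ 0) (h : MSlow r k M) :
    MSlow r k (fun n x => (M n x).adjugate) := by
  intro i j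
  simp only [Matrix.adjugate_fin_two]
  fin_cases i <;> fin_cases j
  · exact h 1 1
  · simpa using (h 0 1).const_mul hr (-1)
  · simpa using (h 1 0).const_mul hr (-1)
  · exact h 0 0

theorem MSlow.one (hr : r ≠ 0) : MSlow r 0 (fun (_ : ℕ) (_ : ι) => (1 : Matrix (Fin 2) (Fin 2) ℝ)) :=
  fun _ _ => Slow.const hr _

end SlowMatrices

/-! ### Traceless matrices almost invariant under conjugation -/

section AlmostInvariant

/-- The traceless part of a `2 × 2` matrix. -/
noncomputable def traceless (A : Matrix (Fin 2) (Fin 2) ℝ) : Matrix (Fin 2) (Fin 2) ℝ :=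
  A - (A.trace / 2) • 1

theorem traceless_eq (A : Matrix (Fin 2) (Fin 2) ℝ) :
    traceless A = !![(A 0 0 - A 1 1) / 2, A 0 1; A 1 0, -((A 0 0 - A 1 1) / 2)] := by
  ext i j
  fin_cases i <;> fin_cases j <;> simp [traceless, Matrix.trace_fin_two] <;> ring

theorem trace_traceless (A : Matrix (Fin 2) (Fin 2) ℝ) : (traceless A).trace = 0 := by
  rw [traceless_eq]; simp [Matrix.trace_fin_two]

theorem det_traceless (A : Matrix (Fin 2) (Fin 2) ℝ) : (traceless A).det = -A.discr / 4 := by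
  rw [traceless_eq, Matrix.discr_fin_two, Matrix.trace_fin_two, Matrix.det_fin_two_of,
    Matrix.det_fin_two]
  ring

theorem det_eq_traceless (A : Matrix (Fin 2) (Fin 2) ℝ) :
    A.det = (A.trace / 2) ^ 2 + (traceless A).det := by
  rw [det_traceless, Matrix.discr_fin_two]; ring

theorem traceless_commute (A : Matrix (Fin 2) (Fin 2) ℝ) : A * traceless A = traceless A * A := by
  simp [traceless, mul_sub, sub_mul]

/-- The correction of an almost invariant traceless matrix with defect `F`. -/
noncomputable def correction (A F : Matrix (Fin 2) (Fin 2) ℝ) : Matrix (Fin 2) (Fin 2) ℝ :=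
  (1 / 4 * (traceless A).det⁻¹) • (F * A * traceless A - traceless A * (F * A))

/-- The correction of the scalar factor for the defect `F`. -/
noncomputable def factorCorrection (A F : Matrix (Fin 2) (Fin 2) ℝ) : ℝ :=
  -1 / 2 * (traceless A).det⁻¹ * (F * traceless A).trace

theorem trace_correction (A F : Matrix (Fin 2) (Fin 2) ℝ) : (correction A F).trace = 0 := by
  rw [correction, Matrix.trace_smul, Matrix.trace_sub, Matrix.trace_mul_comm (F * A), sub_self,
    smul_zero]

/-- Let T be the traceless part of A, so T² = -det T. If F is trace-orthogonal to T, then G = FA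
anticommutes with T, hence [[G, T], T] = -4 det T · G, and η = [G, T] / (4 det T) solves ηA - Aη =
-FA. If F is a multiple of T, the correction vanishes and F survives as its component tr(FT) /
tr(T²) along T, which is the scalar on the right. -/
theorem correction_spec {A B F : Matrix (Fin 2) (Fin 2) ℝ} (hAB : A * B = 1) (hF : F.trace = 0)
    (hd : (traceless A).det ≠ 0) :
    F + correction A F - A * correction A F * B = factorCorrection A F • traceless A := by
  suffices h : F * A + correction A F * A - A * correction A F =
      factorCorrection A F • (traceless A * A) by
    have := congrArg (· * B) h
    simpa [sub_mul, add_mul, mul_assoc, hAB] using this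
  have hF' : F 1 1 = -F 0 0 := by rw [Matrix.trace_fin_two] at hF; linarith
  have hE : F = !![F 0 0, F 0 1; F 1 0, -F 0 0] := by
    ext i j; fin_cases i <;> fin_cases j <;> simp [hF']
  have hA : A = !![A 0 0, A 0 1; A 1 0, A 1 1] := Matrix.eta_fin_two A
  have hdet : (traceless A).det = -((A 0 0 - A 1 1) / 2) ^ 2 - A 0 1 * A 1 0 := by
    rw [traceless_eq, Matrix.det_fin_two_of]; ring
  -- With the denominator cleared the claim is a polynomial identity in the entries.
  have key : (4 * (traceless A).det) • (F * A) +
      ((F * A * traceless A - traceless A * (F * A)) * A -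
        A * (F * A * traceless A - traceless A * (F * A))) =
      (-2 * (F * traceless A).trace) • (traceless A * A) := by
    rw [hdet, traceless_eq]
    generalize A 0 0 = p at *
    generalize A 0 1 = q at *
    generalize A 1 0 = s at *
    generalize A 1 1 = t at *
    generalize F 0 0 = u at *
    generalize F 0 1 = v at *
    generalize F 1 0 = w at *
    subst hE hA
    ext i j
    fin_cases i <;> fin_cases j <;> simp [Matrix.trace_fin_two] <;> ring
  have := congrArg (fun Z => (1 / 4 * (traceless A).det⁻¹) • Z) key
  simp only [smul_add, smul_sub, smul_smul] at this
  have e1 : 1 / 4 * (traceless A).det⁻¹ * (4 * (traceless A).det) = 1 := by field_simp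
  have e2 : 1 / 4 * (traceless A).det⁻¹ * (-2 * (F * traceless A).trace) =
      factorCorrection A F := by rw [factorCorrection]; ring
  rw [e1, e2, one_smul] at this
  rw [← this]
  simp only [correction, smul_mul_assoc, mul_smul_comm, add_sub_assoc]

variable {ι : Type*} {r k : ℕ} {A : ℕ → ι → Matrix (Fin 2) (Fin 2) ℝ}

/-- `S_{n+1} - (1 + lam_n) A_n S_n A_n⁻¹`. -/
noncomputable def defect (A S : ℕ → ι → Matrix (Fin 2) (Fin 2) ℝ) (lam : ℕ → ι → ℝ) :
    ℕ → ι → Matrix (Fin 2) (Fin 2) ℝ :=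
  fun n x => S (n + 1) x - (1 + lam n x) • (A n x * S n x * (A n x)⁻¹)

theorem MSlow.traceless (hr : r ≠ 0) (h : MSlow r 0 A) :
    MSlow r 0 (fun n x => traceless (A n x)) := by
  refine h.sub hr (P := fun n x => ((A n x).trace / 2) • 1) ?_
  have ht : Slow r 0 (fun n x => (A n x).trace / 2) := by
    simpa only [div_eq_inv_mul] using h.trace.const_mul hr 2⁻¹
  exact MSlow.smul ht (MSlow.one hr)

theorem MSlow.det_traceless_inv (hr : r ≠ 0) (h : MSlow r 0 A) {δ : ℝ} (hδ : 0 < δ)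
    (hd : ∀ n x, δ ≤ (JacobiTransfer.traceless (A n x)).det) :
    Slow r 0 (fun n x => (JacobiTransfer.traceless (A n x)).det⁻¹) :=
  ((h.traceless hr).det hr).inv hr hδ fun n x => (hd n x).trans (le_abs_self _)

/-- Since det A = (tr A / 2)² + det T, a lower bound for det T also controls the inverse of A. -/
theorem le_det_of_le_det_traceless {δ : ℝ} {A : Matrix (Fin 2) (Fin 2) ℝ}
    (hd : δ ≤ (JacobiTransfer.traceless A).det) : δ ≤ A.det := by
  rw [det_eq_traceless]; nlinarith

theorem MSlow.inv (hr : r ≠ 0) (h : MSlow r 0 A) {δ : ℝ} (hδ : 0 < δ)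
    (hd : ∀ n x, δ ≤ (A n x).det) : MSlow r 0 (fun n x => (A n x)⁻¹) := by
  have h1 := ((h.det hr).inv hr hδ fun n x => (hd n x).trans (le_abs_self _))
  convert MSlow.smul h1 (h.adjugate hr) using 1
  ext n x
  simp [Matrix.inv_def]

/-- Every order of almost invariance is attained by a slow family of traceless matrices close to
the traceless parts. -/
theorem exists_slow_defect (hr : r ≠ 0) (h : MSlow r 0 A) {δ : ℝ} (hδ : 0 < δ)
    (hd : ∀ n x, δ ≤ (traceless (A n x)).det) (hk : 1 ≤ k) :
    ∃ (S : ℕ → ι → Matrix (Fin 2) (Fin 2) ℝ) (lam : ℕ → ι → ℝ),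
      (∀ n x, (S n x).trace = 0) ∧ MSlow r 1 (S - fun n x => traceless (A n x)) ∧
      Slow r 1 lam ∧ MSlow r k (defect A S lam) := by
  have hA0 := h.traceless hr
  have hdet : ∀ n x, δ ≤ (A n x).det := fun n x => le_det_of_le_det_traceless (hd n x)
  have hB := h.inv hr hδ hdet
  have hAB : ∀ n x, A n x * (A n x)⁻¹ = 1 := fun n x =>
    Matrix.mul_nonsing_inv _ (isUnit_iff_ne_zero.2 (hδ.trans_le (hdet n x)).ne')
  have hfix : ∀ n x, A n x * traceless (A n x) * (A n x)⁻¹ = traceless (A n x) := fun n x => by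
    rw [traceless_commute, mul_assoc, hAB, mul_one]
  have hdinv := h.det_traceless_inv hr hδ hd
  induction k, hk using Nat.le_induction with
  | base =>
    -- The traceless part commutes with A_n, so its defect is just its forward difference, of order
    -- one.
    refine ⟨fun n x => traceless (A n x), 0, fun n x => trace_traceless _, ?_, Slow.zero hr, ?_⟩
    · intro i j
      simp only [sub_self, Pi.zero_apply, Matrix.zero_apply]
      exact Slow.zero hr
    · convert hA0.fdiff using 1
      ext n x
      simp [defect, hfix]
  | succ k hk ih =>
    obtain ⟨S, lam, hS0, hS, hlam, hf⟩ := ih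
    have htr : ∀ n x, (defect A S lam n x).trace = 0 := fun n x => by
      rw [defect, Matrix.trace_sub, Matrix.trace_smul, Matrix.trace_mul_comm, ← mul_assoc,
        Matrix.nonsing_inv_mul _ (isUnit_iff_ne_zero.2 (hδ.trans_le (hdet n x)).ne'), one_mul,
        hS0, hS0]
      simp
    have heta : MSlow r k (fun n x => correction (A n x) (defect A S lam n x)) := by
      have h1 := (hf.mul h).mul hA0
      have h2 := hA0.mul (hf.mul h)
      rw [zero_add] at h2
      have := MSlow.smul (hdinv.const_mul hr (1 / 4)) (h1.sub hr h2)
      rw [zero_add] at this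
      exact this
    have hmu : Slow r k (fun n x => factorCorrection (A n x) (defect A S lam n x)) := by
      have := (hdinv.const_mul hr (-1 / 2)).mul (hf.mul hA0).trace
      rw [zero_add] at this
      exact this
    set eta := fun n x => correction (A n x) (defect A S lam n x) with heta_def
    set mu := fun n x => factorCorrection (A n x) (defect A S lam n x) with hmu_def
    have hlam' : Slow r 1 (lam + mu) := hlam.add (hmu.mono hk)
    refine ⟨S + eta, lam + mu, fun n x => ?_, ?_, hlam', ?_⟩
    · simp [hS0, heta_def, trace_correction, Matrix.trace_add]
    · have := hS.add (heta.mono hk)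
      rwa [sub_add_eq_add_sub] at this
    -- With η = `eta`, μ = `mu` and T the traceless part, the correction cancels the old defect up
    -- to Δη, (λ + μ) AηA⁻¹ and μ A(S - T)A⁻¹. Each is of order k + 1: a difference of an order-k
    -- term, or a product of orders 1 and k.
    · have h1 := heta.fdiff
      have h2 := MSlow.smul hlam' ((h.mul heta).mul hB)
      have h3 := MSlow.smul hmu ((h.mul hS).mul hB)
      rw [show 1 + (0 + k + 0) = k + 1 by omega] at h2
      rw [show k + (0 + 1 + 0) = k + 1 by omega] at h3
      convert (h1.sub hr h2).sub hr h3 using 1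
      ext1 n
      ext1 x
      have hspec := correction_spec (hAB n x) (htr n x) (hδ.trans_le (hd n x)).ne'
      change _ + eta n x - A n x * eta n x * _ = mu n x • _ at hspec
      have hspec' : defect A S lam n x =
          mu n x • traceless (A n x) - eta n x + A n x * eta n x * (A n x)⁻¹ := by
        rw [← hspec]; abel
      have hdef : S (n + 1) x = defect A S lam n x +
          (1 + lam n x) • (A n x * S n x * (A n x)⁻¹) := by
        simp [defect]
      have hfix' := hfix n x
      simp only [Pi.sub_apply, Pi.mul_apply]
      rw [defect]
      simp only [Pi.add_apply]
      rw [hdef, hspec', mul_sub, sub_mul, hfix', mul_add, add_mul]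
      module

end AlmostInvariant

/-! ### Quadratic forms of traceless matrices and their near conservation -/

section Energy

/-- The squared Euclidean norm of a vector of the plane. -/
def normSq (v : Fin 2 → ℝ) : ℝ := v 0 ^ 2 + v 1 ^ 2

/-- The determinant of two vectors of the plane. -/
def cross (v w : Fin 2 → ℝ) : ℝ := v 0 * w 1 - v 1 * w 0

theorem normSq_nonneg (v : Fin 2 → ℝ) : 0 ≤ normSq v := by unfold normSq; positivity

theorem cross_sq_le (v w : Fin 2 → ℝ) : cross v w ^ 2 ≤ normSq v * normSq w := by
  unfold cross normSq; nlinarith [sq_nonneg (v 0 * w 0 + v 1 * w 1)]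

theorem cross_mulVec (A : Matrix (Fin 2) (Fin 2) ℝ) (v w : Fin 2 → ℝ) :
    cross (A *ᵥ v) (A *ᵥ w) = A.det * cross v w := by
  simp [cross, Matrix.mulVec, dotProduct, Fin.sum_univ_two, Matrix.det_fin_two]; ring

theorem cross_add_right (v w z : Fin 2 → ℝ) : cross v (w + z) = cross v w + cross v z := by
  simp [cross]; ring

theorem cross_smul_right (c : ℝ) (v w : Fin 2 → ℝ) : cross v (c • w) = c * cross v w := by
  simp [cross]; ring

variable {c δ ε : ℝ} {S S' A F : Matrix (Fin 2) (Fin 2) ℝ} {lam : ℝ}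

theorem abs_mulVec_le (hA : ∀ i j, |A i j| ≤ c) (v : Fin 2 → ℝ) (i : Fin 2) :
    |(A *ᵥ v) i| ≤ c * (|v 0| + |v 1|) := by
  simp only [Matrix.mulVec, dotProduct, Fin.sum_univ_two]
  calc |A i 0 * v 0 + A i 1 * v 1| ≤ |A i 0| * |v 0| + |A i 1| * |v 1| := by
        rw [← abs_mul, ← abs_mul]; exact abs_add_le _ _
    _ ≤ c * |v 0| + c * |v 1| := by gcongr <;> exact hA _ _
    _ = _ := by ring

theorem sq_abs_add_le_normSq (v : Fin 2 → ℝ) : (|v 0| + |v 1|) ^ 2 ≤ 2 * normSq v := by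
  unfold normSq
  nlinarith [sq_nonneg (|v 0| - |v 1|), sq_abs (v 0), sq_abs (v 1)]

theorem abs_cross_le (v w : Fin 2 → ℝ) {p q : ℝ} (hv : ∀ i, |v i| ≤ p) (hw : ∀ i, |w i| ≤ q) :
    |cross v w| ≤ 2 * (p * q) := by
  have hp : 0 ≤ p := (abs_nonneg _).trans (hv 0)
  unfold cross
  calc |v 0 * w 1 - v 1 * w 0| ≤ |v 0| * |w 1| + |v 1| * |w 0| := by
        rw [← abs_mul, ← abs_mul]; exact abs_sub _ _
    _ ≤ p * q + p * q := by gcongr <;> first | exact hv _ | exact hw _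
    _ = _ := by ring

/-- Completing the square: an off-diagonal entry of S times the form is, up to sign, a square plus
det S times the square of one coordinate. -/
theorem det_mul_normSq_le (hS : ∀ i j, |S i j| ≤ c) (htr : S.trace = 0) (v : Fin 2 → ℝ) :
    S.det * normSq v ≤ 2 * c * |cross v (S *ᵥ v)| := by
  have h11 : S 1 1 = -S 0 0 := by rw [Matrix.trace_fin_two] at htr; linarith
  have hq : cross v (S *ᵥ v) = S 1 0 * v 0 ^ 2 - 2 * S 0 0 * (v 0 * v 1) - S 0 1 * v 1 ^ 2 := by
    simp [cross, Matrix.mulVec, dotProduct, Fin.sum_univ_two, h11]; ring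
  have h1 : S.det * v 1 ^ 2 ≤ c * |cross v (S *ᵥ v)| := by
    calc S.det * v 1 ^ 2 ≤ S 1 0 * cross v (S *ᵥ v) := by
          rw [hq, Matrix.det_fin_two, h11]; nlinarith [sq_nonneg (S 1 0 * v 0 - S 0 0 * v 1)]
      _ ≤ |S 1 0 * cross v (S *ᵥ v)| := le_abs_self _
      _ ≤ _ := by rw [abs_mul]; gcongr; exact hS _ _
  have h0 : S.det * v 0 ^ 2 ≤ c * |cross v (S *ᵥ v)| := by
    calc S.det * v 0 ^ 2 ≤ -(S 0 1 * cross v (S *ᵥ v)) := by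
          rw [hq, Matrix.det_fin_two, h11]; nlinarith [sq_nonneg (S 0 1 * v 1 + S 0 0 * v 0)]
      _ ≤ |S 0 1 * cross v (S *ᵥ v)| := neg_le_abs _
      _ ≤ _ := by rw [abs_mul]; gcongr; exact hS _ _
  unfold normSq
  linarith

theorem abs_det_le (hA : ∀ i j, |A i j| ≤ c) : |A.det| ≤ 2 * c ^ 2 := by
  have hc : 0 ≤ c := (abs_nonneg _).trans (hA 0 0)
  rw [Matrix.det_fin_two]
  calc |A 0 0 * A 1 1 - A 0 1 * A 1 0| ≤ |A 0 0| * |A 1 1| + |A 0 1| * |A 1 0| := by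
        rw [← abs_mul, ← abs_mul]; exact abs_sub _ _
    _ ≤ c * c + c * c := by gcongr <;> exact hA _ _
    _ = _ := by ring

theorem abs_det_sub_sub_det_le (hε : ε ≤ c) (hS : ∀ i j, |S i j| ≤ c) (hF : ∀ i j, |F i j| ≤ ε) :
    |(S - F).det - S.det| ≤ 6 * c * ε := by
  have hc : 0 ≤ c := (abs_nonneg _).trans (hS 0 0)
  have he : 0 ≤ ε := (abs_nonneg _).trans (hF 0 0)
  have hm : ∀ i j i' j', |S i j * F i' j'| ≤ c * ε := fun i j i' j' => by
    rw [abs_mul]; gcongr; exacts [hS _ _, hF _ _]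
  have hd := abs_det_le hF
  have : (S - F).det - S.det =
      F.det - S 0 0 * F 1 1 - S 1 1 * F 0 0 + S 0 1 * F 1 0 + S 1 0 * F 0 1 := by
    simp [Matrix.det_fin_two]; ring
  rw [this]
  have h1 := abs_le.1 (hm 0 0 1 1)
  have h2 := abs_le.1 (hm 1 1 0 0)
  have h3 := abs_le.1 (hm 0 1 1 0)
  have h4 := abs_le.1 (hm 1 0 0 1)
  have h5 := abs_le.1 hd
  have h6 : ε ^ 2 ≤ c * ε := by nlinarith
  rw [abs_le]
  constructor <;> linarith [h1.1, h1.2, h2.1, h2.2, h3.1, h3.2, h4.1, h4.2, h5.1, h5.2]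

/-- The square of the quadratic form `v ↦ det (v, S v)`, normalized by the determinant. -/
noncomputable def energy (S : Matrix (Fin 2) (Fin 2) ℝ) (v : Fin 2 → ℝ) : ℝ :=
  cross v (S *ᵥ v) ^ 2 / S.det

/-- The form is definite of unspecified sign, so its square is used; this makes the energy
comparable to |v|⁴. -/
theorem normSq_sq_le_energy (hδ : 0 < δ) (hdet : δ ≤ S.det) (hS : ∀ i j, |S i j| ≤ c)
    (htr : S.trace = 0) (v : Fin 2 → ℝ) : δ * normSq v ^ 2 ≤ 4 * c ^ 2 * energy S v := by
  have hd : 0 < S.det := hδ.trans_le hdet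
  have h := det_mul_normSq_le hS htr v
  have h2 := pow_le_pow_left₀ (mul_nonneg hd.le (normSq_nonneg v)) h 2
  rw [mul_pow, mul_pow, sq_abs] at h2
  have h3 : S.det * normSq v ^ 2 ≤ 4 * c ^ 2 * energy S v := by
    rw [energy, ← mul_div_assoc, le_div_iff₀ hd]
    linarith
  nlinarith [sq_nonneg (normSq v)]

theorem energy_le_normSq_sq (hδ : 0 < δ) (hdet : δ ≤ S.det) (hS : ∀ i j, |S i j| ≤ c)
    (v : Fin 2 → ℝ) : δ * energy S v ≤ 16 * c ^ 2 * normSq v ^ 2 := by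
  have hc : 0 ≤ c := (abs_nonneg _).trans (hS 0 0)
  have hd : 0 < S.det := hδ.trans_le hdet
  have h1 : |cross v (S *ᵥ v)| ≤ 4 * c * normSq v := by
    have h := abs_cross_le v (S *ᵥ v) (p := |v 0| + |v 1|)
      (fun i => by fin_cases i <;> simp) (abs_mulVec_le hS v)
    nlinarith [sq_abs_add_le_normSq v]
  have h2 := pow_le_pow_left₀ (abs_nonneg _) h1 2
  rw [sq_abs] at h2
  have h3 : δ * energy S v ≤ cross v (S *ᵥ v) ^ 2 := by
    rw [energy, ← mul_div_assoc, div_le_iff₀ hd]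
    nlinarith [sq_nonneg (cross v (S *ᵥ v))]
  nlinarith

theorem energy_nonneg (hδ : 0 < δ) (hdet : δ ≤ S.det) (v : Fin 2 → ℝ) : 0 ≤ energy S v :=
  div_nonneg (sq_nonneg _) (hδ.le.trans hdet)

/-- The energy is almost preserved, up to the determinant, along an almost invariant pair. -/
theorem exists_energy_mulVec_le (hδ : 0 < δ) (hc : 0 ≤ c) :
    ∃ C, 0 ≤ C ∧ ∀ (S S' A F : Matrix (Fin 2) (Fin 2) ℝ) (lam ε : ℝ) (v : Fin 2 → ℝ),
      S' = F + (1 + lam) • (A * S * A⁻¹) → S.trace = 0 → δ ≤ S.det → δ ≤ S'.det → δ ≤ A.det →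
      (∀ i j, |S i j| ≤ c) → (∀ i j, |S' i j| ≤ c) → (∀ i j, |A i j| ≤ c) → |lam| ≤ c → ε ≤ c →
      (∀ i j, |F i j| ≤ ε) → energy S' (A *ᵥ v) ≤ A.det ^ 2 * (1 + C * ε) * energy S v := by
  set C1 := 16 * c ^ 3 / δ with hC1
  set C2 := 2 * (1 + c) * (2 * c ^ 2) * C1 + C1 ^ 2 * c with hC2
  have hC1' : 0 ≤ C1 := by positivity
  have hC2' : 0 ≤ C2 := by positivity
  -- The first term pays for the change of determinant caused by F, the second for the change of the
  -- form. The factor δ³ comes from (det A)² ≥ δ² and det S' ≥ δ.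
  refine ⟨6 * c / δ + C2 * (2 * c ^ 2) / δ ^ 3, by positivity, ?_⟩
  intro S S' A F lam ε v hS' htr hdS hdS' hdA hS hSb hA hlam hεc hF
  have he : 0 ≤ ε := (abs_nonneg _).trans (hF 0 0)
  have hDS : 0 < S.det := hδ.trans_le hdS
  have hDS' : 0 < S'.det := hδ.trans_le hdS'
  have hDA : 0 < A.det := hδ.trans_le hdA
  have hunit : IsUnit A.det := isUnit_iff_ne_zero.2 hDA.ne'
  set q := cross v (S *ᵥ v) with hq
  set w := cross (A *ᵥ v) (F *ᵥ (A *ᵥ v)) with hw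
  have hq' : cross (A *ᵥ v) (S' *ᵥ (A *ᵥ v)) = (1 + lam) * A.det * q + w := by
    have h1 : S' *ᵥ (A *ᵥ v) = (1 + lam) • (A *ᵥ (S *ᵥ v)) + F *ᵥ (A *ᵥ v) := by
      rw [hS', Matrix.add_mulVec, Matrix.smul_mulVec, Matrix.mulVec_mulVec, Matrix.mulVec_mulVec,
        Matrix.mulVec_mulVec, mul_assoc (A * S), Matrix.nonsing_inv_mul _ hunit, mul_one, add_comm]
    rw [h1, cross_add_right, cross_smul_right, cross_mulVec, mul_assoc]
  have hw1 : |w| ≤ 8 * c ^ 2 * ε * normSq v := by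
    have h0 : ∀ i, |(F *ᵥ (A *ᵥ v)) i| ≤ ε * (2 * (c * (|v 0| + |v 1|))) := fun i => by
      refine (abs_mulVec_le hF _ i).trans (mul_le_mul_of_nonneg_left ?_ he)
      linarith [abs_mulVec_le hA v 0, abs_mulVec_le hA v 1]
    have h := abs_cross_le _ _ (abs_mulVec_le hA v) h0
    have hs := sq_abs_add_le_normSq v
    calc |w| ≤ 4 * c ^ 2 * ε * (|v 0| + |v 1|) ^ 2 := by rw [hw]; linarith
      _ ≤ 4 * c ^ 2 * ε * (2 * normSq v) := by gcongr
      _ = _ := by ring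
  have hw2 : |w| ≤ C1 * ε * |q| := by
    have h1 : normSq v ≤ 2 * c / δ * |q| := by
      rw [div_mul_eq_mul_div, le_div_iff₀ hδ]
      have := det_mul_normSq_le hS htr v
      nlinarith [normSq_nonneg v]
    calc |w| ≤ 8 * c ^ 2 * ε * (2 * c / δ * |q|) := hw1.trans (by gcongr)
      _ = _ := by rw [hC1]; ring
  have hDA' : A.det ≤ 2 * c ^ 2 := (le_abs_self _).trans (abs_det_le hA)
  have hDSb : S.det ≤ 2 * c ^ 2 := (le_abs_self _).trans (abs_det_le hS)
  have hqsq : ((1 + lam) * A.det * q + w) ^ 2 ≤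
      q ^ 2 * ((1 + lam) ^ 2 * A.det ^ 2 + C2 * ε) := by
    have h1 : |1 + lam| ≤ 1 + c := (abs_add_le _ _).trans (by simpa using hlam)
    have h2 : (1 + lam) * A.det * q * w ≤ (1 + c) * (2 * c ^ 2) * |q| * (C1 * ε * |q|) := by
      refine (le_abs_self _).trans ?_
      rw [abs_mul, abs_mul, abs_mul, abs_of_pos hDA]
      gcongr
    have h3 : w ^ 2 ≤ C1 ^ 2 * c * ε * q ^ 2 := by
      rw [← sq_abs w, ← sq_abs q]
      calc |w| ^ 2 ≤ (C1 * ε * |q|) ^ 2 := by gcongr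
        _ = C1 ^ 2 * (ε * ε) * |q| ^ 2 := by ring
        _ ≤ C1 ^ 2 * (c * ε) * |q| ^ 2 := by gcongr
        _ = _ := by ring
    have h4 : |q| * |q| = q ^ 2 := by rw [← sq, sq_abs]
    calc ((1 + lam) * A.det * q + w) ^ 2
        = q ^ 2 * ((1 + lam) ^ 2 * A.det ^ 2) + 2 * ((1 + lam) * A.det * q * w) + w ^ 2 := by ring
      _ ≤ q ^ 2 * ((1 + lam) ^ 2 * A.det ^ 2) +
          2 * ((1 + c) * (2 * c ^ 2) * |q| * (C1 * ε * |q|)) + C1 ^ 2 * c * ε * q ^ 2 := by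
            gcongr
      _ = q ^ 2 * ((1 + lam) ^ 2 * A.det ^ 2) +
          2 * ((1 + c) * (2 * c ^ 2) * (C1 * ε)) * (|q| * |q|) + C1 ^ 2 * c * ε * q ^ 2 := by ring
      _ = _ := by rw [h4, hC2]; ring
  -- S' - F is (1 + λ) times a conjugate of S. This puts the same factor (1 + λ)² into the
  -- determinant as into the squared form, so λ need not be summable.
  have hdet : (1 + lam) ^ 2 * S.det ≤ S'.det + 6 * c * ε := by
    have h1 : (S' - F).det = (1 + lam) ^ 2 * S.det := by
      rw [hS', add_sub_cancel_left, Matrix.det_smul, Matrix.det_mul, Matrix.det_mul,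
        Matrix.det_nonsing_inv, Ring.inverse_eq_inv', Fintype.card_fin]
      field_simp
    have h2 := abs_le.1 (abs_det_sub_sub_det_le hεc hSb hF)
    rw [h1] at h2
    linarith [h2.2]
  have hfin : ((1 + lam) ^ 2 * A.det ^ 2 + C2 * ε) * S.det ≤
      A.det ^ 2 * (1 + (6 * c / δ + C2 * (2 * c ^ 2) / δ ^ 3) * ε) * S'.det := by
    have h1 : 6 * c * ε ≤ 6 * c / δ * ε * S'.det := by
      calc 6 * c * ε = 6 * c / δ * ε * δ := by field_simp
        _ ≤ _ := by gcongr
    have h2 : C2 * ε * S.det ≤ A.det ^ 2 * (C2 * (2 * c ^ 2) / δ ^ 3 * ε) * S'.det := by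
      calc C2 * ε * S.det ≤ C2 * ε * (2 * c ^ 2) := by gcongr
        _ = δ ^ 2 * (C2 * (2 * c ^ 2) / δ ^ 3 * ε) * δ := by field_simp
        _ ≤ _ := by gcongr
    have h3 : A.det ^ 2 * ((1 + lam) ^ 2 * S.det) ≤ A.det ^ 2 * (S'.det + 6 * c / δ * ε * S'.det) :=
      mul_le_mul_of_nonneg_left (by linarith) (sq_nonneg _)
    linarith
  rw [energy, energy, hq', ← hq, ← mul_div_assoc, div_le_div_iff₀ hDS' hDS]
  calc ((1 + lam) * A.det * q + w) ^ 2 * S.det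
      ≤ q ^ 2 * ((1 + lam) ^ 2 * A.det ^ 2 + C2 * ε) * S.det := by gcongr
    _ = q ^ 2 * (((1 + lam) ^ 2 * A.det ^ 2 + C2 * ε) * S.det) := by ring
    _ ≤ q ^ 2 * (A.det ^ 2 * (1 + (6 * c / δ + C2 * (2 * c ^ 2) / δ ^ 3) * ε) * S'.det) := by
        gcongr
    _ = _ := by ring

/-- Discrete Grönwall inequality, from 1 + t ≤ exp t. -/
theorem le_exp_tsum_mul {t y : ℕ → ℝ} (ht : ∀ n, 0 ≤ t n) (hs : Summable t) (hy : ∀ n, 0 ≤ y n)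
    (h : ∀ n, y (n + 1) ≤ (1 + t n) * y n) (n : ℕ) : y n ≤ Real.exp (∑' k, t k) * y 0 := by
  have key : y n ≤ Real.exp (∑ k ∈ Finset.range n, t k) * y 0 := by
    induction n with
    | zero => simp
    | succ n ih =>
      rw [Finset.sum_range_succ, add_comm (∑ k ∈ Finset.range n, t k), Real.exp_add, mul_assoc]
      refine (h n).trans (mul_le_mul ?_ ih (hy n) (Real.exp_pos _).le)
      linarith [Real.add_one_le_exp (t n)]
  refine key.trans (mul_le_mul_of_nonneg_right (Real.exp_le_exp.2 ?_) (hy 0))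
  exact hs.sum_le_tsum _ fun k _ => ht k

end Energy

/-! ### Two-sided bounds for solutions of v_{n+1} = A_n v_n -/

section Growth

variable {ι : Type*} {r : ℕ} {A : ℕ → ι → Matrix (Fin 2) (Fin 2) ℝ} {α : ℕ → ℝ} {δ : ℝ}

theorem MSlow.exists_bound {k : ℕ} (h : MSlow r k A) :
    ∃ C, 0 ≤ C ∧ ∀ n x i j, |A n x i j| ≤ C := by
  choose C hC h using fun i j => (h i j).powerBounded.exists_bound
  refine ⟨∑ i, ∑ j, C i j, Finset.sum_nonneg fun i _ => Finset.sum_nonneg fun j _ => hC i j,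
    fun n x i j => (h i j n x).trans ?_⟩
  exact (Finset.single_le_sum (f := fun j => C i j) (fun j _ => hC i j) (Finset.mem_univ j)).trans
    (Finset.single_le_sum (f := fun i => ∑ j, C i j)
      (fun i _ => Finset.sum_nonneg fun j _ => hC i j) (Finset.mem_univ i))

theorem MSlow.exists_summable (h : MSlow r r A) :
    ∃ s : ℕ → ℝ, (∀ n, 0 ≤ s n) ∧ Summable s ∧ ∀ n x i j, |A n x i j| ≤ s n := by
  choose s hs hsum h using fun i j => (h i j).powerBounded.exists_summable
  refine ⟨fun n => ∑ i, ∑ j, s i j n,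
    fun n => Finset.sum_nonneg fun i _ => Finset.sum_nonneg fun j _ => hs i j n,
    summable_sum fun i _ => summable_sum fun j _ => hsum i j, fun n x i j => (h i j n x).trans ?_⟩
  exact (Finset.single_le_sum (f := fun j => s i j n) (fun j _ => hs i j n)
    (Finset.mem_univ j)).trans (Finset.single_le_sum (f := fun i => ∑ j, s i j n)
      (fun i _ => Finset.sum_nonneg fun j _ => hs i j n) (Finset.mem_univ i))

theorem exists_normSq_le (hr : r ≠ 0) (h : MSlow r 0 A) (hδ : 0 < δ)
    (hd : ∀ n x, δ ≤ (traceless (A n x)).det) (hα : ∀ n, 0 < α n)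
    (hαA : ∀ n x, α (n + 1) * (A n x).det = α n) :
    ∃ M C, 0 < C ∧ ∀ x (v : ℕ → Fin 2 → ℝ), (∀ n, v (n + 1) = A (M + n) x *ᵥ v n) →
      ∀ n, α (M + n) * normSq (v n) ≤ C * (α M * normSq (v 0)) := by
  -- Order k = r is where the bound on the defect becomes summable.
  obtain ⟨S, lam, hS0, hS, hlam, hf⟩ := exists_slow_defect hr h hδ hd
    (Nat.one_le_iff_ne_zero.2 hr)
  have hSs : MSlow r 0 S := by
    have := (hS.mono (Nat.zero_le 1)).add (h.traceless hr)
    rwa [sub_add_cancel] at this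
  obtain ⟨c1, hc1, hAb⟩ := h.exists_bound
  obtain ⟨c2, hc2, hSb⟩ := hSs.exists_bound
  obtain ⟨c3, hc3, hlamb⟩ := hlam.powerBounded.exists_bound
  obtain ⟨s, hs0, hss, hsf⟩ := hf.exists_summable
  -- S differs from the traceless part by a term of order one, which tends to zero uniformly; half
  -- of the lower bound δ therefore survives from some index on.
  obtain ⟨M, hM⟩ : ∃ M, ∀ n, M ≤ n → s n ≤ 1 ∧ ∀ x, δ / 2 ≤ (S n x).det := by
    have hdet : Slow r 1 ((fun n x => (S n x).det) - fun n x => (traceless (A n x)).det) := by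
      have e : ((fun n x => (S n x).det) - fun n x => (traceless (A n x)).det) =
          (((fun n x => (S n x 0 0 - traceless (A n x) 0 0)) * (fun n x => S n x 1 1) +
            (fun n x => traceless (A n x) 0 0) * fun n x => S n x 1 1 - traceless (A n x) 1 1) -
          ((fun n x => (S n x 0 1 - traceless (A n x) 0 1)) * (fun n x => S n x 1 0) +
            (fun n x => traceless (A n x) 0 1) * fun n x => S n x 1 0 - traceless (A n x) 1 0)) := by
        ext n x
        simp [Matrix.det_fin_two]; ring
      rw [e]
      have hT := h.traceless hr
      have h1 := (hS 0 0).mul (hSs 1 1)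
      have h2 := (hT 0 0).mul (hS 1 1)
      have h3 := (hS 0 1).mul (hSs 1 0)
      have h4 := (hT 0 1).mul (hS 1 0)
      rw [zero_add] at h2 h4
      exact (h1.add h2).sub hr (h3.add h4)
    have h1 := hdet.powerBounded.eventually_le hr one_ne_zero (half_pos hδ)
    have h2 := hss.tendsto_atTop_zero.eventually (gt_mem_nhds zero_lt_one)
    obtain ⟨M, hM⟩ := Filter.eventually_atTop.1 (h1.and h2)
    refine ⟨M, fun n hn => ⟨(hM n hn).2.le, fun x => ?_⟩⟩
    have h3 := (abs_le.1 ((hM n hn).1 x)).1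
    simp only [Pi.sub_apply] at h3
    linarith [hd n x]
  set c := c1 + c2 + c3 + 1 with hcdef
  have hc : 0 < c := by positivity
  obtain ⟨C, hC, hstep⟩ := exists_energy_mulVec_le (half_pos hδ) hc.le
  set E := Real.exp (∑' k, C * s (M + k)) with hE
  have hsum : Summable fun k => C * s (M + k) := by
    simp only [add_comm M]
    exact ((summable_nat_add_iff M).2 hss).mul_left C
  set C' := 4 * c ^ 2 / (δ / 2) * E * (16 * c ^ 2 / (δ / 2)) with hC'
  have hC'pos : 0 < C' := by positivity
  refine ⟨M, Real.sqrt C', Real.sqrt_pos.2 hC'pos, fun x v hv n => ?_⟩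
  have hSc : ∀ n i j, |S n x i j| ≤ c := fun n i j => (hSb n x i j).trans (by linarith)
  have hdS : ∀ n, δ / 2 ≤ (S (M + n) x).det := fun n => (hM _ (Nat.le_add_right _ _)).2 x
  have hen : ∀ n, 0 ≤ energy (S (M + n) x) (v n) := fun n => energy_nonneg (half_pos hδ) (hdS n) _
  have hgrow := le_exp_tsum_mul (y := fun n => α (M + n) ^ 2 * energy (S (M + n) x) (v n))
    (t := fun k => C * s (M + k)) (fun n => mul_nonneg hC (hs0 _)) hsum
    (fun n => mul_nonneg (sq_nonneg _) (hen n)) (fun n => by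
      have h1 := hstep (S (M + n) x) (S (M + n + 1) x) (A (M + n) x) (defect A S lam (M + n) x)
        (lam (M + n) x) (s (M + n)) (v n) (by simp [defect]) (hS0 _ _) (hdS n) (hdS (n + 1))
        (by linarith [le_det_of_le_det_traceless (hd (M + n) x)]) (hSc _) (hSc _)
        (fun i j => (hAb _ x i j).trans (by linarith)) ((hlamb _ x).trans (by linarith))
        ((hM _ (Nat.le_add_right _ _)).1.trans (by linarith)) (hsf _ x)
      rw [← hv n] at h1
      have h2 := mul_le_mul_of_nonneg_left h1 (sq_nonneg (α (M + n + 1)))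
      refine h2.trans (le_of_eq ?_)
      -- The weight relation absorbs the factor (det A)² exactly.
      rw [← hαA (M + n) x]
      ring) n
  simp only [add_zero] at hgrow
  have h1 := normSq_sq_le_energy (half_pos hδ) (hdS n) (hSc _) (hS0 _ _) (v n)
  have h2 := energy_le_normSq_sq (half_pos hδ) (hdS 0) (hSc _) (v 0)
  rw [add_zero] at h2
  have h1' : normSq (v n) ^ 2 ≤ 4 * c ^ 2 / (δ / 2) * energy (S (M + n) x) (v n) := by
    rw [div_mul_eq_mul_div, le_div_iff₀ (half_pos hδ)]; linarith
  have h2' : energy (S M x) (v 0) ≤ 16 * c ^ 2 / (δ / 2) * normSq (v 0) ^ 2 := by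
    rw [div_mul_eq_mul_div, le_div_iff₀ (half_pos hδ)]; linarith
  have hfin : (α (M + n) * normSq (v n)) ^ 2 ≤ C' * (α M * normSq (v 0)) ^ 2 := by
    calc (α (M + n) * normSq (v n)) ^ 2 = α (M + n) ^ 2 * normSq (v n) ^ 2 := by ring
      _ ≤ α (M + n) ^ 2 * (4 * c ^ 2 / (δ / 2) * energy (S (M + n) x) (v n)) := by gcongr
      _ = 4 * c ^ 2 / (δ / 2) * (α (M + n) ^ 2 * energy (S (M + n) x) (v n)) := by ring
      _ ≤ 4 * c ^ 2 / (δ / 2) * (E * (α M ^ 2 * energy (S M x) (v 0))) := by gcongr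
      _ ≤ 4 * c ^ 2 / (δ / 2) * (E * (α M ^ 2 * (16 * c ^ 2 / (δ / 2) * normSq (v 0) ^ 2))) := by
          gcongr
      _ = _ := by rw [hC']; ring
  have := Real.sqrt_le_sqrt hfin
  rwa [Real.sqrt_sq (mul_nonneg (hα _).le (normSq_nonneg _)), Real.sqrt_mul hC'pos.le,
    Real.sqrt_sq (mul_nonneg (hα _).le (normSq_nonneg _))] at this

/-- The weighted Wronskian of v with a solution w started orthogonally at the same length is
constant, equal to α_M |v_0|². Cauchy–Schwarz and the upper bound for w then keep v from being
small. -/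
theorem exists_normSq_le_and_le (hr : r ≠ 0) (h : MSlow r 0 A) (hδ : 0 < δ)
    (hd : ∀ n x, δ ≤ (traceless (A n x)).det) (hα : ∀ n, 0 < α n)
    (hαA : ∀ n x, α (n + 1) * (A n x).det = α n) :
    ∃ M C, 0 < C ∧ ∀ x (v : ℕ → Fin 2 → ℝ), (∀ n, v (n + 1) = A (M + n) x *ᵥ v n) →
      ∀ n, α (M + n) * normSq (v n) ≤ C * (α M * normSq (v 0)) ∧
        α M * normSq (v 0) ≤ C * (α (M + n) * normSq (v n)) := by
  obtain ⟨M, C, hC, hup⟩ := exists_normSq_le hr h hδ hd hα hαA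
  refine ⟨M, C, hC, fun x v hv n => ⟨hup x v hv n, ?_⟩⟩
  -- compare with the solution starting from the rotated vector
  let w : ℕ → Fin 2 → ℝ := fun n =>
    Nat.rec ![-v 0 1, v 0 0] (fun n z => A (M + n) x *ᵥ z) n
  have hw : ∀ n, w (n + 1) = A (M + n) x *ᵥ w n := fun n => rfl
  have hw0 : normSq (w 0) = normSq (v 0) := by simp [w, normSq]; ring
  have hcross : ∀ n, α (M + n) * cross (v n) (w n) = α M * normSq (v 0) := fun n => by
    induction n with
    | zero =>
      have : cross (v 0) (w 0) = normSq (v 0) := by simp [w, cross, normSq]; ring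
      rw [this, add_zero]
    | succ n ih =>
      rw [hv, hw, cross_mulVec, ← mul_assoc, ← ih, ← hαA (M + n) x]
      rfl
  have h1 := cross_sq_le (v n) (w n)
  have h2 := hup x w hw n
  rw [hw0] at h2
  set X := α M * normSq (v 0) with hX
  set Y := α (M + n) * normSq (v n) with hY
  have hX0 : 0 ≤ X := mul_nonneg (hα _).le (normSq_nonneg _)
  have hY0 : 0 ≤ Y := mul_nonneg (hα _).le (normSq_nonneg _)
  have h3 : X ^ 2 ≤ Y * (C * X) := by
    calc X ^ 2 = α (M + n) ^ 2 * cross (v n) (w n) ^ 2 := by rw [← hcross n]; ring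
      _ ≤ α (M + n) ^ 2 * (normSq (v n) * normSq (w n)) := by gcongr
      _ = Y * (α (M + n) * normSq (w n)) := by rw [hY]; ring
      _ ≤ Y * (C * X) := by gcongr
  rcases hX0.eq_or_lt with h0 | h0
  · rw [← h0]; positivity
  · nlinarith

end Growth

/-! ### From pointwise to uniform negativity of the discriminants -/

section UniformLimit

open Polynomial in
/-- Polynomials of bounded degree with pointwise negative limits on a compact set are eventually
uniformly negative there. -/
theorem exists_eval_le_neg {K : Set ℝ} (hK : IsCompact K) (hne : K.Nonempty) {d : ℕ}
    (p : ℕ → ℝ[X]) (hp : ∀ k, (p k).natDegree ≤ d)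
    (hlim : ∀ x ∈ K, ∃ h : ℝ, h < 0 ∧ Filter.Tendsto (fun k => (p k).eval x) Filter.atTop (𝓝 h)) :
    ∃ δ > 0, ∃ M, ∀ k, M ≤ k → ∀ x ∈ K, (p k).eval x ≤ -δ := by
  classical
  choose! h hneg hten using hlim
  -- Finitely many nodes in K determine the values on K: all of K if it is finite, otherwise any d +
  -- 1 of its points. Convergence of the polynomials is thus convergence of a vector of node values.
  obtain ⟨s, hsK, hs⟩ : ∃ s : Finset ℝ, ↑s ⊆ K ∧
      ∀ k, ∀ x ∈ K, (p k).eval x = (Lagrange.interpolate s id fun y => (p k).eval y).eval x := by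
    rcases K.finite_or_infinite with hf | hi
    · refine ⟨hf.toFinset, by simp, fun k x hx => ?_⟩
      exact (Lagrange.eval_interpolate_at_node (fun y => (p k).eval y) (Function.injective_id.injOn)
        (hf.mem_toFinset.2 hx)).symm
    · obtain ⟨s, hsK, hcard⟩ := hi.exists_subset_card_eq (d + 1)
      refine ⟨s, hsK, fun k x _ => ?_⟩
      rw [← Lagrange.eq_interpolate_of_eval_eq (f := p k) (v := id) (s := s)
        (fun y => (p k).eval y) Function.injective_id.injOn ?_ fun _ _ => rfl]
      rw [hcard]
      exact (Polynomial.degree_le_natDegree).trans_lt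
        (by exact_mod_cast Nat.lt_succ_of_le (hp k))
  let F : (s → ℝ) → ℝ → ℝ := fun c x => ∑ y : s, c y * (Lagrange.basis s id (y : ℝ)).eval x
  have hF : Continuous fun z : (s → ℝ) × ℝ => F z.1 z.2 := by
    refine continuous_finsetSum _ fun y _ => ?_
    exact ((continuous_apply y).comp continuous_fst).mul
      ((Polynomial.continuous _).comp continuous_snd)
  have hFk : ∀ k, ∀ x ∈ K, (p k).eval x = F (fun y => (p k).eval (y : ℝ)) x := fun k x hx => by
    rw [hs k x hx, Lagrange.interpolate_apply, Polynomial.eval_finsetSum]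
    simp only [F, Polynomial.eval_mul, Polynomial.eval_C]
    exact (Finset.sum_coe_sort s fun y => (p k).eval y * (Lagrange.basis s id y).eval x).symm
  have hc : Filter.Tendsto (fun k (y : s) => (p k).eval (y : ℝ)) Filter.atTop
      (𝓝 fun y : s => h y) := tendsto_pi_nhds.2 fun y => hten _ (hsK y.2)
  have hFh : ∀ x ∈ K, F (fun y => h y) x = h x := fun x hx => by
    have h1 : Filter.Tendsto (fun k => F (fun y => (p k).eval (y : ℝ)) x) Filter.atTop
        (𝓝 (F (fun y => h y) x)) :=
      ((hF.comp (Continuous.prodMk_left x)).tendsto (fun y : s => h y)).comp hc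
    refine tendsto_nhds_unique h1 ((hten x hx).congr fun k => hFk k x hx)
  obtain ⟨x₀, hx₀, hmax⟩ := hK.exists_isMaxOn hne
    (f := fun x => F (fun y : s => h y) x) (hF.comp (Continuous.prodMk_right _)).continuousOn
  refine ⟨-h x₀ / 2, by linarith [hneg x₀ hx₀], ?_⟩
  -- The interpolant is jointly continuous in node values and x, so compactness of K makes the
  -- strict inequality at the limit values stable.
  have hev : ∀ᶠ c in 𝓝 (fun y : s => h y), ∀ x ∈ K, F c x < h x₀ / 2 := by
    refine hK.eventually_forall_of_forall_eventually fun x hx => ?_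
    have h1 : F (fun y : s => h y) x < h x₀ / 2 := by
      have := hmax hx
      simp only [Set.mem_ofPred_eq, hFh x₀ hx₀] at this
      linarith [hneg x₀ hx₀]
    exact hF.continuousAt.eventually (gt_mem_nhds h1)
  obtain ⟨M, hM⟩ := Filter.eventually_atTop.1 (hc.eventually hev)
  refine ⟨M, fun k hk x hx => ?_⟩
  rw [hFk k x hx]
  linarith [hM k hk x hx]

end UniformLimit

/-! ### Algebra of the N-step transfer matrices -/

section Transfer

variable {a b : ℕ → ℝ}

open Polynomial in
theorem exists_polynomial_nStep (a b : ℕ → ℝ) (N n : ℕ) : ∃ P : Fin 2 → Fin 2 → ℝ[X],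
    (∀ i j, (P i j).natDegree ≤ N) ∧ ∀ x i j, nStep a b N n x i j = (P i j).eval x := by
  induction N with
  | zero =>
    refine ⟨fun i j => C ((1 : Matrix (Fin 2) (Fin 2) ℝ) i j), fun i j => ?_, fun x i j => ?_⟩
    · simp
    · simp [nStep]
  | succ N ih =>
    obtain ⟨P, hP, h⟩ := ih
    refine ⟨fun i j => ![P 1 j, C (-(a (n + N - 1) / a (n + N))) * P 0 j +
      C (a (n + N))⁻¹ * (X - C (b (n + N))) * P 1 j] i, fun i j => ?_, fun x i j => ?_⟩
    · fin_cases i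
      · exact (hP 1 j).trans (Nat.le_succ N)
      · refine natDegree_add_le_of_degree_le ?_ ?_
        · exact (natDegree_C_mul_le _ _).trans ((hP 0 j).trans (Nat.le_succ N))
        · refine natDegree_mul_le.trans ?_
          have h1 := (natDegree_C_mul_le (a (n + N))⁻¹ (X - C (b (n + N)))).trans
            (natDegree_X_sub_C_le _)
          have := hP 1 j
          omega
    · fin_cases i
      · simp [nStep, oneStep, Matrix.mul_apply, Fin.sum_univ_two, h]
      · simp only [nStep, oneStep, Matrix.mul_apply, Fin.sum_univ_two, h, Fin.mk_one,
          Matrix.of_apply, Matrix.cons_val_one, Matrix.cons_val_zero, Matrix.cons_val_fin_one,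
          eval_add, eval_mul, eval_sub, eval_C, eval_X]
        ring

open Polynomial in
theorem exists_polynomial_discr_nStep (a b : ℕ → ℝ) (N n : ℕ) : ∃ p : ℝ[X],
    p.natDegree ≤ N + N ∧ ∀ x, (nStep a b N n x).discr = p.eval x := by
  obtain ⟨P, hP, h⟩ := exists_polynomial_nStep a b N n
  refine ⟨(P 0 0 + P 1 1) * (P 0 0 + P 1 1) - C 4 * (P 0 0 * P 1 1 - P 0 1 * P 1 0), ?_,
    fun x => ?_⟩
  · have hmul : ∀ {p q : ℝ[X]}, p.natDegree ≤ N → q.natDegree ≤ N → (p * q).natDegree ≤ N + N :=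
      fun hp hq => natDegree_mul_le.trans (Nat.add_le_add hp hq)
    refine natDegree_sub_le_of_le (m := N + N) (n := N + N) ?_ ?_ |>.trans (by simp)
    · have := natDegree_add_le_of_degree_le (hP 0 0) (hP 1 1)
      exact hmul this this
    · refine (natDegree_C_mul_le _ _).trans ?_
      exact (natDegree_sub_le_of_le (hmul (hP _ _) (hP _ _)) (hmul (hP _ _) (hP _ _))).trans
        (by simp)
  · rw [Matrix.discr_fin_two, Matrix.trace_fin_two, Matrix.det_fin_two]
    simp only [h, eval_sub, eval_mul, eval_add, eval_C]
    ring

/-- The one-step determinants a_{n-1} / a_n telescope; this is the source of the weight in the final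
estimate. -/
theorem det_nStep (ha : ∀ n, 0 < a n) (N : ℕ) {n : ℕ} (hn : 1 ≤ n) (x : ℝ) :
    a (n + N - 1) * (nStep a b N n x).det = a (n - 1) := by
  induction N with
  | zero => simp [nStep]
  | succ N ih =>
    have h1 : (oneStep a b (n + N) x).det = a (n + N - 1) / a (n + N) := by
      simp [oneStep, Matrix.det_fin_two]
    have h2 := (ha (n + N)).ne'
    rw [nStep, Matrix.det_mul, h1, show n + (N + 1) - 1 = n + N by omega, ← mul_assoc,
      mul_div_cancel₀ _ h2, ih]

theorem nStep_mulVec (ha : ∀ n, 0 < a n) {x : ℝ} {u : ℕ → ℝ}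
    (hu : ∀ n : ℕ, 1 ≤ n → a (n - 1) * u (n - 1) + b n * u n + a n * u (n + 1) = x * u n)
    (N : ℕ) {n : ℕ} (hn : 1 ≤ n) :
    nStep a b N n x *ᵥ ![u (n - 1), u n] = ![u (n + N - 1), u (n + N)] := by
  induction N with
  | zero => simp [nStep]
  | succ N ih =>
    rw [nStep, ← Matrix.mulVec_mulVec, ih]
    have h1 := hu (n + N) (by omega)
    have h2 := (ha (n + N)).ne'
    ext i
    fin_cases i
    · simp [oneStep, Matrix.mulVec, dotProduct, Fin.sum_univ_two]
    · simp [oneStep, Matrix.mulVec, dotProduct, Fin.sum_univ_two]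
      rw [← add_assoc]
      field_simp
      linarith

/-- The Cauchy data at any index are comparable, uniformly on bounded sets of spectral parameters,
to the initial data. -/
theorem exists_compare_initial (ha : ∀ n, 0 < a n) {K : Set ℝ} {R : ℝ} (hR : ∀ x ∈ K, |x| ≤ R)
    (m : ℕ) : ∃ C, 0 < C ∧ ∀ x ∈ K, ∀ u : ℕ → ℝ,
      (∀ n : ℕ, 1 ≤ n → a (n - 1) * u (n - 1) + b n * u n + a n * u (n + 1) = x * u n) →
      u m ^ 2 + u (m + 1) ^ 2 ≤ C * (u 0 ^ 2 + u 1 ^ 2) ∧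
        u 0 ^ 2 + u 1 ^ 2 ≤ C * (u m ^ 2 + u (m + 1) ^ 2) := by
  induction m with
  | zero => exact ⟨1, one_pos, fun x _ u _ => by simp⟩
  | succ m ih =>
    obtain ⟨C, hC, h⟩ := ih
    set β := |b (m + 1)| with hβ
    set T := (|R| + β) ^ 2 with hT
    set D := 1 + 2 * (T + a m ^ 2) / a (m + 1) ^ 2 + 2 * (T + a (m + 1) ^ 2) / a m ^ 2 with hD
    have ha0 := ha m
    have ha1 := ha (m + 1)
    have hT0 : 0 ≤ T := sq_nonneg _
    have hp1 : 0 ≤ 2 * (T + a m ^ 2) / a (m + 1) ^ 2 := by positivity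
    have hp2 : 0 ≤ 2 * (T + a (m + 1) ^ 2) / a m ^ 2 := by positivity
    have hD0 : 0 < D := by positivity
    refine ⟨C * D, by positivity, fun x hx u hu => ?_⟩
    obtain ⟨h1, h2⟩ := h x hx u hu
    have hrec := hu (m + 1) (by omega)
    rw [Nat.add_sub_cancel] at hrec
    have hxb : (x - b (m + 1)) ^ 2 ≤ T := by
      rw [hT, ← sq_abs]
      refine pow_le_pow_left₀ (abs_nonneg _) ((abs_sub _ _).trans ?_) 2
      linarith [hR x hx, le_abs_self R]
    -- The recurrence can be solved for either outer term, so one estimate serves both directions.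
    have aux : ∀ {p q y z w t : ℝ}, 0 < q → q * w = t * y - p * z → t ^ 2 ≤ T →
        w ^ 2 ≤ 2 * (T + p ^ 2) / q ^ 2 * (z ^ 2 + y ^ 2) := by
      intro p q y z w t hq he ht
      rw [div_mul_eq_mul_div, le_div_iff₀ (by positivity), ← mul_pow, mul_comm w, he]
      nlinarith [sq_nonneg (t * y + p * z), mul_le_mul_of_nonneg_right ht (sq_nonneg y),
        mul_nonneg hT0 (sq_nonneg z), mul_nonneg (sq_nonneg p) (sq_nonneg y)]
    have hfor := aux (p := a m) (q := a (m + 1)) (y := u (m + 1)) (z := u m) (w := u (m + 2))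
      ha1 (by linarith) hxb
    have hback := aux (p := a (m + 1)) (q := a m) (y := u (m + 1)) (z := u (m + 2)) (w := u m)
      ha0 (by linarith) hxb
    have hU : u (m + 1) ^ 2 + u (m + 2) ^ 2 ≤ D * (u m ^ 2 + u (m + 1) ^ 2) := by
      rw [hD]
      nlinarith [sq_nonneg (u m), sq_nonneg (u (m + 1))]
    have hV : u m ^ 2 + u (m + 1) ^ 2 ≤ D * (u (m + 1) ^ 2 + u (m + 2) ^ 2) := by
      rw [hD]
      nlinarith [sq_nonneg (u (m + 2)), sq_nonneg (u (m + 1))]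
    constructor
    · refine hU.trans ?_
      rw [mul_comm C, mul_assoc]
      gcongr
    · refine h2.trans ?_
      rw [mul_assoc]
      gcongr

end Transfer

/-! ### The Stolz class condition implies slowness -/

section StolzClass

variable {r : ℕ} {K : Set ℝ} {X : ℕ → ℝ → Matrix (Fin 2) (Fin 2) ℝ}

theorem abs_entry_le_l2_opNorm (A : Matrix (Fin 2) (Fin 2) ℝ) (i j : Fin 2) : |A i j| ≤ ‖A‖ := by
  have h := Matrix.l2_opNorm_mulVec A (EuclideanSpace.single j 1)
  rw [PiLp.norm_single, norm_one, mul_one] at h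
  refine le_trans ?_ ((PiLp.norm_apply_le _ i).trans h)
  simp

theorem norm_iterDiff_le {C : ℝ} (hC : ∀ n : ℕ, 1 ≤ n → ∀ x ∈ K, ‖X n x‖ ≤ C) (j : ℕ) :
    ∀ n : ℕ, 1 ≤ n → ∀ x ∈ K, ‖iterDiff X j n x‖ ≤ 2 ^ j * C := by
  induction j with
  | zero => simpa [iterDiff] using hC
  | succ j ih =>
    intro n hn x hx
    rw [iterDiff, pow_succ]
    linarith [norm_sub_le (iterDiff X j (n + 1) x) (iterDiff X j n x), ih n hn x hx,
      ih (n + 1) (by omega) x hx]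

theorem InStolzClass.powerBounded (hr : r ≠ 0) (h : InStolzClass r K X) (p q : Fin 2) (j : ℕ) :
    PowerBounded r j (fun n (x : K) => iterDiff X j (n + 1) x p q) := by
  obtain ⟨C, hC⟩ := h.bounded
  have hb := norm_iterDiff_le hC
  induction j with
  | zero =>
    exact PowerBounded.of_bounded hr (2 ^ 0 * C) fun n x =>
      (abs_entry_le_l2_opNorm _ _ _).trans (hb 0 _ (by omega) _ x.2)
  | succ j ih =>
    by_cases hj : j + 1 ≤ r
    · set σ : ℕ → ℝ := fun n => ⨆ x : K, ‖iterDiff X (j + 1) (n + 1) x‖ with hσ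
      have hσ0 : ∀ n, 0 ≤ σ n := fun n => Real.iSup_nonneg fun x => norm_nonneg _
      have hle : ∀ n (x : K), |iterDiff X (j + 1) (n + 1) x p q| ≤ σ n := fun n x =>
        (abs_entry_le_l2_opNorm _ _ _).trans
          (le_ciSup (f := fun x : K => ‖iterDiff X (j + 1) (n + 1) x‖)
            ⟨2 ^ (j + 1) * C, by rintro _ ⟨y, rfl⟩; exact hb _ _ (by omega) _ y.2⟩ x)
      -- The majorant is the (j + 1)-th root of σ, whose r-th power is the summable quantity of the
      -- hypothesis, capped at 1. Where the cap is active, uniform boundedness supplies the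
      -- constant.
      have hroot : ∀ n, 0 ≤ σ n ^ (((j + 1 : ℕ) : ℝ)⁻¹) := fun n => Real.rpow_nonneg (hσ0 n) _
      refine ⟨fun n => min 1 (σ n ^ (((j + 1 : ℕ) : ℝ)⁻¹)), fun n => le_min zero_le_one (hroot n),
        fun n => min_le_left _ _, ?_, max 1 (2 ^ (j + 1) * C), zero_le_one.trans (le_max_left _ _),
        fun n x => ?_⟩
      · refine Summable.of_nonneg_of_le
          (fun n => pow_nonneg (le_min zero_le_one (hroot n)) _) (fun n => ?_)
          (h.summable (j + 1) (by omega) hj)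
        refine (pow_le_pow_left₀ (le_min zero_le_one (hroot n)) (min_le_right _ _) r).trans_eq ?_
        rw [← Real.rpow_natCast, ← Real.rpow_mul (hσ0 n), mul_comm, ← div_eq_mul_inv]
      · rw [min_eq_left hj]
        beta_reduce
        rcases le_total 1 (σ n ^ (((j + 1 : ℕ) : ℝ)⁻¹)) with h1 | h1
        · rw [min_eq_left h1, one_pow, mul_one]
          exact ((abs_entry_le_l2_opNorm _ _ _).trans (hb _ _ (by omega) _ x.2)).trans
            (le_max_right _ _)
        · rw [min_eq_right h1, Real.rpow_inv_natCast_pow (hσ0 n) (Nat.succ_ne_zero j)]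
          exact (hle n x).trans (le_mul_of_one_le_left (hσ0 n) (le_max_left _ _))
    -- Beyond order r, a difference of two terms that already have the truncated exponent.
    · have := (ih.shift.add (ih.const_mul (-1))).of_le (l := j + 1) (by omega)
      convert this using 1
      ext n x
      simp [iterDiff, shift]
      ring

theorem InStolzClass.mslow (hr : r ≠ 0) (h : InStolzClass r K X) (m : ℕ) :
    MSlow r 0 (fun n (x : K) => X (n + m + 1) x) := by
  intro p q
  have key : ∀ J j, SlowUpTo r J j (fun n (x : K) => iterDiff X j (n + 1) x p q) := by
    intro J
    induction J with
    | zero => exact fun j => h.powerBounded hr p q j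
    | succ J ih => exact fun j => ⟨h.powerBounded hr p q j, ih (j + 1)⟩
  induction m with
  | zero => exact fun J => key J 0
  | succ m ih =>
    convert ih.shift using 1
    ext n x
    simp only [shift]
    rw [show n + (m + 1) + 1 = n + 1 + m + 1 by omega]

end StolzClass

end JacobiTransfer

theorem theoremA (a b : ℕ → ℝ) (ha : ∀ n, 0 < a n)
    (N r i : ℕ) (hN : 1 ≤ N) (hr : 1 ≤ r) (hi : i < N)
    (K : Set ℝ) (hK : IsCompact K) (hKΛ : K ⊆ JacobiTransfer.ellipticSet a b N i)
    (hratio : Filter.Tendsto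
      (fun n : ℕ => a ((n + 1) * N + i - 1) / a (n * N + i - 1)) Filter.atTop (nhds 1))
    (hX : JacobiTransfer.InStolzClass r K
      (fun n x => JacobiTransfer.nStep a b N (n * N + i) x)) :
    ∃ c : ℝ, 1 < c ∧ ∀ x ∈ K, ∀ u : ℕ → ℝ, JacobiTransfer.IsGenEigenvector a b x u →
      ∀ n : ℕ, 1 ≤ n →
        c⁻¹ * (u 0 ^ 2 + u 1 ^ 2) ≤
            a (n * N + i - 1) * (u (n * N + i - 1) ^ 2 + u (n * N + i) ^ 2) ∧
          a (n * N + i - 1) * (u (n * N + i - 1) ^ 2 + u (n * N + i) ^ 2) ≤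
            c * (u 0 ^ 2 + u 1 ^ 2) := by
  open JacobiTransfer in
  rcases K.eq_empty_or_nonempty with rfl | hne
  · exact ⟨2, one_lt_two, fun x hx => absurd hx (Set.notMem_empty x)⟩
  have hr0 : r ≠ 0 := Nat.one_le_iff_ne_zero.1 hr
  have hpos : ∀ n, 1 ≤ n → 1 ≤ n * N + i := fun n hn => by nlinarith
  -- the discriminants are eventually uniformly negative
  choose p hpdeg hp using fun k => exists_polynomial_discr_nStep a b N (k * N + i)
  obtain ⟨δ, hδ, m, hm⟩ := exists_eval_le_neg hK hne p hpdeg fun x hx => by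
    obtain ⟨h, hneg, ht⟩ := hKΛ hx
    exact ⟨h, hneg, ht.congr fun k => hp k x⟩
  -- The offset m + 1 skips the indices before the discriminants are uniformly negative and also
  -- index 0, where the subtraction of 1 could truncate.
  set A : ℕ → K → Matrix (Fin 2) (Fin 2) ℝ :=
    fun n x => nStep a b N ((n + m + 1) * N + i) x with hA
  set α : ℕ → ℝ := fun n => a ((n + m + 1) * N + i - 1) with hα
  obtain ⟨M, C, hC, hmain⟩ := exists_normSq_le_and_le (A := A) (α := α) hr0 (hX.mslow hr0 m)
    (show 0 < δ / 4 by positivity) (fun n x => by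
      rw [det_traceless, hA, hp]
      linarith [hm (n + m + 1) (by omega) x x.2]) (fun n => ha _) (fun n x => by
      have := det_nStep (b := b) ha N (hpos (n + m + 1) (by omega)) (x : ℝ)
      rwa [show (n + m + 1) * N + i + N - 1 = (n + 1 + m + 1) * N + i - 1 by
        congr 1; ring] at this)
  obtain ⟨R, hR⟩ := hK.isBounded.exists_norm_le
  -- The condition 1 ≤ n sits inside so that the constants form a sequence defined for all n.
  have hcmp : ∀ n, ∃ D, 0 < D ∧ (1 ≤ n → ∀ x ∈ K, ∀ u : ℕ → ℝ, IsGenEigenvector a b x u →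
      a (n * N + i - 1) * (u (n * N + i - 1) ^ 2 + u (n * N + i) ^ 2) ≤
          D * (u 0 ^ 2 + u 1 ^ 2) ∧
        u 0 ^ 2 + u 1 ^ 2 ≤
          D * (a (n * N + i - 1) * (u (n * N + i - 1) ^ 2 + u (n * N + i) ^ 2))) := fun n => by
    obtain ⟨D, hD, h⟩ := exists_compare_initial (b := b) ha hR (n * N + i - 1)
    have ha' := ha (n * N + i - 1)
    refine ⟨D * (a (n * N + i - 1) + (a (n * N + i - 1))⁻¹), by positivity,
      fun hn x hx u hu => ?_⟩
    have h1 := h x hx u hu.2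
    rw [Nat.sub_add_cancel (hpos n hn)] at h1
    set U := u 0 ^ 2 + u 1 ^ 2
    set V := u (n * N + i - 1) ^ 2 + u (n * N + i) ^ 2
    have hU : 0 ≤ U := by positivity
    have hV : 0 ≤ V := by positivity
    set t := a (n * N + i - 1)
    constructor
    · calc t * V ≤ t * (D * U) := mul_le_mul_of_nonneg_left h1.1 ha'.le
        _ ≤ t * (D * U) + D * t⁻¹ * U := le_add_of_nonneg_right (by positivity)
        _ = _ := by ring
    · calc U ≤ D * V := h1.2
        _ = D * t⁻¹ * (t * V) := by field_simp
        _ ≤ D * t⁻¹ * (t * V) + D * t * (t * V) := le_add_of_nonneg_right (by positivity)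
        _ = _ := by ring
  choose D hD hcmp using hcmp
  set n₀ := M + m + 1 with hn₀
  -- The sum covers the indices below n₀; from n₀ on, C compares n with n₀ and D n₀ compares n₀ with
  -- the initial data.
  set c := 1 + ∑ k ∈ Finset.range n₀, D k + C * D n₀ with hc
  have hsum : 0 ≤ ∑ k ∈ Finset.range n₀, D k := Finset.sum_nonneg fun k _ => (hD k).le
  have hCD : 0 < C * D n₀ := mul_pos hC (hD n₀)
  have hc1 : 1 < c := by linarith
  refine ⟨c, hc1, fun x hx u hu n hn => ?_⟩
  set U := u 0 ^ 2 + u 1 ^ 2 with hU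
  have hU0 : 0 ≤ U := by positivity
  suffices h : ∃ E, 0 ≤ E ∧ E ≤ c ∧
      a (n * N + i - 1) * (u (n * N + i - 1) ^ 2 + u (n * N + i) ^ 2) ≤ E * U ∧
      U ≤ E * (a (n * N + i - 1) * (u (n * N + i - 1) ^ 2 + u (n * N + i) ^ 2)) by
    obtain ⟨E, hE0, hEc, h1, h2⟩ := h
    have hV : 0 ≤ a (n * N + i - 1) * (u (n * N + i - 1) ^ 2 + u (n * N + i) ^ 2) :=
      mul_nonneg (ha _).le (by positivity)
    refine ⟨?_, h1.trans (mul_le_mul_of_nonneg_right hEc hU0)⟩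
    rw [inv_mul_le_iff₀ (zero_lt_one.trans hc1)]
    exact h2.trans (mul_le_mul_of_nonneg_right hEc hV)
  rcases lt_or_ge n n₀ with hlt | hge
  · refine ⟨D n, (hD n).le, ?_, hcmp n hn x hx u hu⟩
    have := Finset.single_le_sum (f := D) (fun k _ => (hD k).le) (Finset.mem_range.2 hlt)
    linarith
  · obtain ⟨k, rfl⟩ := Nat.exists_eq_add_of_le hge
    refine ⟨C * D n₀, hCD.le, by linarith, ?_⟩
    have h1 := hmain ⟨x, hx⟩ (fun k => ![u ((M + k + m + 1) * N + i - 1),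
      u ((M + k + m + 1) * N + i)]) (fun k => by
        have := nStep_mulVec ha hu.2 N (hpos (M + k + m + 1) (by omega))
        simp only [hA]
        rw [this, show (M + (k + 1) + m + 1) * N + i = (M + k + m + 1) * N + i + N by ring]) k
    have h2 := hcmp n₀ (by omega) x hx u hu
    simp only [normSq, hα, Matrix.cons_val_zero, Matrix.cons_val_one, Matrix.cons_val_fin_one,
      add_zero, ← hn₀] at h1
    rw [show M + k + m + 1 = n₀ + k by omega] at h1
    refine ⟨h1.1.trans ?_, h2.2.trans ?_⟩
    · rw [mul_assoc]
      exact mul_le_mul_of_nonneg_left h2.1 hC.le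
    · rw [mul_comm C, mul_assoc]
      exact mul_le_mul_of_nonneg_left h1.2 (hD n₀).le
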